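/- Let $G$ be a finite group acting linearly and faithfully on $\mathbb{R}^n$, and let $G$ act on $\mathbb{R}[\underline X]=\mathbb{R}[X_1,\dots,X_n]$ by $(\sigma h)(x)=h(\sigma^{-1}x)$. Let $\pi_1,\dots,\pi_m$ generate the $\mathbb{R}$-algebra $\mathbb{R}[\underline X]^G$ of invariants, let $\Pi=(\pi_1,\dots,\pi_m):\mathbb{R}^n\to\mathbb{R}^m$ be the Hilbert map, and let $V(I_\Pi)\subseteq\mathbb{R}^m$ be the real zero set of the ideal $I_\Pi\subseteq\mathbb{R}[Z_1,\dots,Z_m]$ of algebraic relations between $\pi_1,\dots,\pi_m$. For $z\in V(I_\Pi)$ let $\varphi_z:\mathbb{R}[\underline X]^G\to\mathbb{R}$ be the homomorphism of $\mathbb{R}$-algebras with $\varphi_z(\pi_j)=z_j$ for all $j$. We say that the orbit space $\Pi(\mathbb{R}^n)$ is \emph{generically described} by $g\in\mathbb{R}[\underline X]^G$ if \[\Pi(\mathbb{R}^n)=\{z\in V(I_\Pi)\mid \varphi_z(g)>0\}\cup T\] for some set $T\subseteq\mathbb{R}^m$ with $\dim T<\dim\Pi(\mathbb{R}^n)$,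 where $\dim S$ is the Krull dimension of $\mathbb{R}[Z_1,\dots,Z_m]/I(S)$ and $I(S)$ is the ideal of the polynomials vanishing on $S$. For a subgroup $H\le G$ let $R_H(h)=\frac1{|H|}\sum_{\sigma\in H}\sigma h$. \textbf{Theorem.} Suppose that every maximal elementary abelian $2$-subgroup of $G$ has order $2$. Then $\Pi(\mathbb{R}^n)$ is generically described by some $g\in\mathbb{R}[\underline X]^G$. More precisely, if $|G|=q2^l$ with $q$ odd and $H_1\subseteq H_2\subseteq\dots\subseteq H_l\subseteq G$ are nested subgroups with $|H_i|=2^i$, then \[g=\prod_{\sigma H_l\in G/H_l}\sigma R_{H_l}\Big(\sum_{i=1}^n\big(X_i-R_{H_1}(X_i)\big)^2\Big)\] is a well-defined element of $\mathbb{R}[\underline X]^G$, and $\Pi(\mathbb{R}^n)$ is generically described by $g$. -/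

import Mathlib

open MvPolynomial

noncomputable section

namespace OrbitSpace

section Action

variable {G : Type*} [Group G] {n : ℕ}

/-- The action of `G` on `ℝ[X₁, …, Xₙ]` that is induced by a linear action `ρ` of `G` on `ℝⁿ`:
`σ` sends the polynomial `h` to the polynomial `x ↦ h (σ⁻¹ x)`. -/
def act (ρ : G →* GL (Fin n) ℝ) (σ : G) :
    MvPolynomial (Fin n) ℝ →ₐ[ℝ] MvPolynomial (Fin n) ℝ :=
  aeval fun i => ∑ j, C ((ρ σ⁻¹ : Matrix (Fin n) (Fin n) ℝ) i j) * X j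

theorem eval_act (ρ : G →* GL (Fin n) ℝ) (σ : G) (h : MvPolynomial (Fin n) ℝ) (x : Fin n → ℝ) :
    eval x (act ρ σ h) = eval ((ρ σ⁻¹ : Matrix (Fin n) (Fin n) ℝ).mulVec x) h := by
  induction h using MvPolynomial.induction_on with
  | C a => simp [act]
  | add p q hp hq => simp [hp, hq]
  | mul_X p i hp =>
    rw [map_mul, map_mul, map_mul, hp]
    simp [act, Matrix.mulVec, dotProduct]

theorem act_mul (ρ : G →* GL (Fin n) ℝ) (σ τ : G) (h : MvPolynomial (Fin n) ℝ) :
    act ρ (σ * τ) h = act ρ σ (act ρ τ h) := by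
  apply MvPolynomial.funext
  intro x
  rw [eval_act, eval_act, eval_act, Matrix.mulVec_mulVec, mul_inv_rev, map_mul, Units.val_mul]

/-- The invariant ring `ℝ[X]^G`. -/
def invariants (ρ : G →* GL (Fin n) ℝ) : Subalgebra ℝ (MvPolynomial (Fin n) ℝ) where
  carrier := {h | ∀ σ : G, act ρ σ h = h}
  mul_mem' ha hb σ := by rw [map_mul, ha σ, hb σ]
  add_mem' ha hb σ := by rw [map_add, ha σ, hb σ]
  algebraMap_mem' r σ := (act ρ σ).commutes r

open Classical in
/-- The Reynolds operator `R_H : h ↦ (1 / |H|) ∑_{σ ∈ H} σ h` of a subgroup `H` of `G`. -/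
def reynolds [Fintype G] (ρ : G →* GL (Fin n) ℝ) (H : Subgroup G) (h : MvPolynomial (Fin n) ℝ) :
    MvPolynomial (Fin n) ℝ :=
  (Nat.card H : ℝ)⁻¹ • ∑ σ ∈ Finset.univ.filter (fun σ : G => σ ∈ H), act ρ σ h

theorem act_reynolds [Fintype G] (ρ : G →* GL (Fin n) ℝ) (H : Subgroup G)
    (h : MvPolynomial (Fin n) ℝ) {τ : G} (hτ : τ ∈ H) :
    act ρ τ (reynolds ρ H h) = reynolds ρ H h := by
  classical
  have key : ∑ σ ∈ Finset.univ.filter (fun σ : G => σ ∈ H), act ρ τ (act ρ σ h) =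
      ∑ σ ∈ Finset.univ.filter (fun σ : G => σ ∈ H), act ρ σ h := by
    refine Finset.sum_bij (fun σ _ => τ * σ) ?_ ?_ ?_ ?_
    · intro σ hσ
      rw [Finset.mem_filter] at hσ ⊢
      exact ⟨Finset.mem_univ _, H.mul_mem hτ hσ.2⟩
    · intro a _ b _ hab
      exact mul_left_cancel hab
    · intro σ hσ
      rw [Finset.mem_filter] at hσ
      exact ⟨τ⁻¹ * σ, Finset.mem_filter.mpr
        ⟨Finset.mem_univ _, H.mul_mem (H.inv_mem hτ) hσ.2⟩, mul_inv_cancel_left τ σ⟩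
    · intro σ _
      rw [act_mul]
  unfold reynolds
  rw [map_smul, map_sum]
  convert congrArg (fun t => (Nat.card H : ℝ)⁻¹ • t) key

/-- The factor `σ R_H(h)`, as a function of the coset `σ H`. -/
def cosetFactor [Fintype G] (ρ : G →* GL (Fin n) ℝ) (H : Subgroup G)
    (h : MvPolynomial (Fin n) ℝ) : G ⧸ H → MvPolynomial (Fin n) ℝ :=
  Quotient.lift (fun σ : G => act ρ σ (reynolds ρ H h)) (by
    intro σ τ hστ
    have hmem : σ⁻¹ * τ ∈ H := QuotientGroup.leftRel_apply.mp hστ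
    have hτ : τ = σ * (σ⁻¹ * τ) := by group
    change act ρ σ (reynolds ρ H h) = act ρ τ (reynolds ρ H h)
    rw [hτ, act_mul, act_reynolds ρ H h hmem])

open Classical in
/-- The product `∏_{σ K ∈ G / K} σ R_K (∑ᵢ (Xᵢ - R_H (Xᵢ))²)`. -/
def cosetProduct [Fintype G] (ρ : G →* GL (Fin n) ℝ) (H K : Subgroup G) :
    MvPolynomial (Fin n) ℝ :=
  ∏ c : G ⧸ K, cosetFactor ρ K (∑ i, (X i - reynolds ρ H (X i)) ^ 2) c

end Action

section HilbertMap

variable {n m : ℕ}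

/-- The Hilbert map `Π : ℝⁿ → ℝᵐ`, `x ↦ (π₁(x), …, πₘ(x))`. -/
def hilbertMap (p : Fin m → MvPolynomial (Fin n) ℝ) (x : Fin n → ℝ) : Fin m → ℝ :=
  fun j => eval x (p j)

/-- The ideal `I_Π ⊆ ℝ[Z₁, …, Zₘ]` of algebraic relations between `π₁, …, πₘ`. -/
def relationIdeal (p : Fin m → MvPolynomial (Fin n) ℝ) : Ideal (MvPolynomial (Fin m) ℝ) :=
  RingHom.ker (aeval p : MvPolynomial (Fin m) ℝ →ₐ[ℝ] MvPolynomial (Fin n) ℝ)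

/-- The real variety `V(I_Π) ⊆ ℝᵐ` of the ideal of relations. -/
def relationVariety (p : Fin m → MvPolynomial (Fin n) ℝ) : Set (Fin m → ℝ) :=
  zeroLocus ℝ (relationIdeal p)

/-- The dimension of a subset `S` of `ℝᵐ`: the Krull dimension of `ℝ[Z₁, …, Zₘ] / I(S)`, where
`I(S)` is the ideal of the polynomials that vanish on `S`. It is `⊥` if `S` is empty. -/
def dim (S : Set (Fin m → ℝ)) : WithBot ℕ∞ :=
  ringKrullDim (MvPolynomial (Fin m) ℝ ⧸ vanishingIdeal ℝ S)

variable {G : Type*} [Group G] {ρ : G →* GL (Fin n) ℝ} {p : Fin m → MvPolynomial (Fin n) ℝ}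

theorem aeval_mem_invariants (hp : Algebra.adjoin ℝ (Set.range p) = invariants ρ)
    (q : MvPolynomial (Fin m) ℝ) : aeval p q ∈ invariants ρ := by
  rw [← hp, Algebra.adjoin_range_eq_range_aeval]
  exact ⟨q, rfl⟩

/-- The substitution `ℝ[Z₁, …, Zₘ] → ℝ[X]^G`, `Zⱼ ↦ πⱼ`. -/
def toInvariants (hp : Algebra.adjoin ℝ (Set.range p) = invariants ρ) :
    MvPolynomial (Fin m) ℝ →ₐ[ℝ] invariants ρ :=
  (aeval p).codRestrict (invariants ρ) (aeval_mem_invariants hp)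

theorem toInvariants_surjective (hp : Algebra.adjoin ℝ (Set.range p) = invariants ρ) :
    Function.Surjective (toInvariants hp) := by
  rintro ⟨f, hf⟩
  have hf' := hf
  rw [← hp, Algebra.adjoin_range_eq_range_aeval] at hf'
  obtain ⟨q, hq⟩ := hf'
  exact ⟨q, Subtype.ext hq⟩

theorem ker_toInvariants_le (hp : Algebra.adjoin ℝ (Set.range p) = invariants ρ) {z : Fin m → ℝ}
    (hz : z ∈ relationVariety p) :
    RingHom.ker (toInvariants hp).toRingHom ≤
      RingHom.ker (aeval z : MvPolynomial (Fin m) ℝ →ₐ[ℝ] ℝ).toRingHom := by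
  intro q hq
  have hq' : toInvariants hp q = 0 := hq
  exact hz q (congrArg Subtype.val hq')

/-- The ring homomorphism `φ_z : ℝ[X]^G → ℝ`, evaluation at the point `z` of `V(I_Π)`. -/
def phi (hp : Algebra.adjoin ℝ (Set.range p) = invariants ρ) (z : Fin m → ℝ)
    (hz : z ∈ relationVariety p) : invariants ρ →ₐ[ℝ] ℝ :=
  AlgHom.liftOfSurjective (toInvariants hp) (toInvariants_surjective hp) (aeval z)
    (ker_toInvariants_le hp hz)

theorem phi_toInvariants (hp : Algebra.adjoin ℝ (Set.range p) = invariants ρ) (z : Fin m → ℝ)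
    (hz : z ∈ relationVariety p) (q : MvPolynomial (Fin m) ℝ) :
    phi hp z hz (toInvariants hp q) = eval z q := by
  rw [← coe_aeval_eq_eval]
  exact AlgHom.liftOfSurjective_apply _ _ _ _ q

/-- The orbit space `Π(ℝⁿ)` is generically described by `f₁, …, fₖ ∈ ℝ[X]^G`: it is the union of
`{z ∈ V(I_Π) | φ_z(f₁) > 0, …, φ_z(fₖ) > 0}` and a set of smaller dimension. -/
def GenericallyDescribedBy (hp : Algebra.adjoin ℝ (Set.range p) = invariants ρ) {k : ℕ}
    (f : Fin k → invariants ρ) : Prop :=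
  ∃ T : Set (Fin m → ℝ), dim T < dim (Set.range (hilbertMap p)) ∧
    Set.range (hilbertMap p) =
      {z | ∃ hz : z ∈ relationVariety p, ∀ i, 0 < phi hp z hz (f i)} ∪ T

end HilbertMap

/-- A subgroup is an elementary abelian 2-group: it is commutative and of exponent dividing 2. -/
def IsElementaryAbelianTwo {G : Type*} [Group G] (E : Subgroup G) : Prop :=
  (∀ x ∈ E, ∀ y ∈ E, x * y = y * x) ∧ ∀ x ∈ E, x ^ 2 = 1

end OrbitSpace

end

/-! On real points `g` is nonnegative, being a product of averages of sums of squares, and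
faithfulness makes `g ≠ 0`; so the part of the orbit space where `g` vanishes has smaller dimension
and can serve as `T`. Conversely, let `z ∈ V(I_Π)` with `φ_z(g) > 0`. Since `ℝ[X]` is integral over
the invariants, `φ_z` extends to a complex point `ψ` (`exists_algHom_complex_extending`). Its
conjugate agrees with it on invariants, hence equals `ψ ∘ s` for some `s ∈ G`
(`exists_eq_comp_act`), and `s` may be taken of 2-power order. If `s = 1`, then `ψ` is a real point
and `z` is its image. If `s ≠ 1`, then `ψ(g) ≤ 0` (`re_apply_cosetProduct_nonpos`), a contradiction.
By the hypothesis on `G`, the 2-group `K = H_l` has a unique involution `ι`, which generates `H_1`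
and is central in `K`. A coset fixed by `s` gives a conjugate of `s` in `K`. If `s² ≠ 1`, a fixed
coset exists because `|G/K|` is odd; there `ι` is an even power of the conjugate, acts trivially,
and the factor vanishes. If `s² = 1`, each fixed coset contributes an average of squares of
imaginary numbers, and the other cosets pair off into complex conjugates; as `|G/K|` is odd, the
product is nonpositive. -/

noncomputable section

namespace OrbitSpace

/-! ### Complex points with the same invariants -/

section Complexification

variable {G : Type*} [Group G] {n : ℕ} (ρ : G →* GL (Fin n) ℝ)

theorem act_one (h : MvPolynomial (Fin n) ℝ) : act ρ 1 h = h := by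
  apply MvPolynomial.funext
  intro x
  simp [eval_act]

theorem act_injective (σ : G) : Function.Injective (act ρ σ) := by
  intro a b hab
  have := congrArg (act ρ σ⁻¹) hab
  rwa [← act_mul, ← act_mul, inv_mul_cancel, act_one, act_one] at this

/-- The action `act` as a `MulSemiringAction`. -/
@[reducible] def mulSemiringAction : MulSemiringAction G (MvPolynomial (Fin n) ℝ) where
  smul σ h := act ρ σ h
  one_smul := act_one ρ
  mul_smul := act_mul ρ
  smul_zero σ := map_zero (act ρ σ)
  smul_add σ := map_add (act ρ σ)
  smul_one σ := map_one (act ρ σ)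
  smul_mul σ := map_mul (act ρ σ)

theorem isIntegral_invariants [Finite G] :
    Algebra.IsIntegral (invariants ρ) (MvPolynomial (Fin n) ℝ) := by
  let _ := mulSemiringAction ρ
  have : Algebra.IsInvariant (invariants ρ) (MvPolynomial (Fin n) ℝ) G :=
    ⟨fun b hb => ⟨⟨b, hb⟩, rfl⟩⟩
  exact Algebra.IsInvariant.isIntegral _ _ G

variable {ρ} in
-- The coefficients of `∏ (T - σ h)` are invariant, so both points map this polynomial to the same
-- one over `ℂ`; `ψ' h` is a root of it. The element `σ` still depends on `h`.
theorem exists_apply_eq_apply_act [Finite G] {ψ ψ' : MvPolynomial (Fin n) ℝ →ₐ[ℝ] ℂ}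
    (hψ : ∀ h ∈ invariants ρ, ψ h = ψ' h) (h : MvPolynomial (Fin n) ℝ) :
    ∃ σ : G, ψ' h = ψ (act ρ σ h) := by
  cases nonempty_fintype G
  let _ := mulSemiringAction ρ
  have hmap : (MulSemiringAction.charpoly G h).map ψ.toRingHom =
      (MulSemiringAction.charpoly G h).map ψ'.toRingHom := by
    ext k
    rw [Polynomial.coeff_map, Polynomial.coeff_map]
    exact hψ _ fun σ => MulSemiringAction.smul_coeff_charpoly h k σ
  have h0 : ((MulSemiringAction.charpoly G h).map ψ'.toRingHom).eval (ψ'.toRingHom h) = 0 := by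
    rw [Polynomial.eval_map_apply, MulSemiringAction.eval_charpoly, map_zero]
  rw [← hmap, MulSemiringAction.charpoly_eq, Polynomial.map_prod, Polynomial.eval_prod,
    Finset.prod_eq_zero_iff] at h0
  obtain ⟨σ, -, hσ⟩ := h0
  refine ⟨σ, ?_⟩
  rw [Polynomial.map_sub, Polynomial.map_X, Polynomial.map_C, Polynomial.eval_sub,
    Polynomial.eval_X, Polynomial.eval_C, sub_eq_zero] at hσ
  exact hσ

variable {ρ} in
/-- Complex points of `ℝⁿ` at which all invariants agree lie in one orbit of `G`. -/
theorem exists_eq_comp_act [Finite G] {ψ ψ' : MvPolynomial (Fin n) ℝ →ₐ[ℝ] ℂ}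
    (hψ : ∀ h ∈ invariants ρ, ψ h = ψ' h) : ∃ σ : G, ψ' = ψ.comp (act ρ σ) := by
  -- A vector space over an infinite field is not a finite union of proper subspaces, so one `σ`
  -- works for every `h`.
  obtain ⟨σ, hσ⟩ := Subspace.exists_eq_top_of_iUnion_eq_univ
    (p := fun σ : G => LinearMap.ker (ψ'.toLinearMap - (ψ.comp (act ρ σ)).toLinearMap)) (by
      rw [Set.eq_univ_iff_forall]
      intro h
      obtain ⟨σ, hσ⟩ := exists_apply_eq_apply_act hψ h
      exact Set.mem_iUnion.mpr ⟨σ, sub_eq_zero.mpr hσ⟩)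
  refine ⟨σ, AlgHom.ext fun h => ?_⟩
  have : h ∈ LinearMap.ker (ψ'.toLinearMap - (ψ.comp (act ρ σ)).toLinearMap) :=
    (congrArg (h ∈ ·) hσ).mpr Submodule.mem_top
  exact sub_eq_zero.mp this

end Complexification

/-! ### Lifting real points, and the sign of conjugation-symmetric products -/

/-- A real point of `A` lifts to a complex point of an integral extension of `A`. -/
theorem exists_algHom_complex_extending {B : Type*} [CommRing B] [Algebra ℝ B]
    (A : Subalgebra ℝ B) [Algebra.IsIntegral A B] (φ : A →ₐ[ℝ] ℝ) :
    ∃ ψ : B →ₐ[ℝ] ℂ, ∀ a : A, ψ a = φ a := by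
  have hP : (RingHom.ker φ).IsPrime := RingHom.ker_isPrime _
  obtain ⟨Q, -, hQ, hQP⟩ := Ideal.exists_ideal_over_prime_of_isIntegral (S := B) (RingHom.ker φ) ⊥
    (by
      intro a ha
      have : a = 0 := Subtype.ext ha
      rw [this]
      exact zero_mem _)
  have hmk : ∀ a : A, Ideal.Quotient.mk Q (a : B) = algebraMap ℝ (B ⧸ Q) (φ a) := by
    intro a
    have h1 : a - algebraMap ℝ A (φ a) ∈ RingHom.ker φ := by
      rw [RingHom.mem_ker, map_sub, AlgHom.commutes]
      exact sub_self _
    rw [← hQP] at h1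
    exact Ideal.Quotient.eq.mpr h1
  -- `A` acts on `B ⧸ Q` through `φ`, so applying `φ` to the coefficients of an integral equation
  -- over `A` gives one over `ℝ`. The domain `B ⧸ Q` then maps to `ℂ`.
  have : Algebra.IsIntegral ℝ (B ⧸ Q) := by
    refine ⟨fun b => ?_⟩
    obtain ⟨b, rfl⟩ := Ideal.Quotient.mk_surjective b
    obtain ⟨P, hP, hPb⟩ := Algebra.IsIntegral.isIntegral (R := A) b
    refine ⟨P.map φ.toRingHom, hP.map _, ?_⟩
    rw [Polynomial.eval₂_map]
    have hcomp : (algebraMap ℝ (B ⧸ Q)).comp φ.toRingHom =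
        (Ideal.Quotient.mk Q).comp (algebraMap A B) := RingHom.ext fun a => (hmk a).symm
    rw [hcomp, ← Polynomial.hom_eval₂, hPb, map_zero]
  let L : B ⧸ Q →ₐ[ℝ] ℂ := IsAlgClosed.lift
  refine ⟨L.comp (Ideal.Quotient.mkₐ ℝ Q), fun a => ?_⟩
  change L (Ideal.Quotient.mk Q (a : B)) = _
  rw [hmk, AlgHom.commutes]
  rfl

/-- A family of complex numbers of odd size that an involution of the index set conjugates,
and which is nonpositive at the fixed points, has a nonpositive product. -/
theorem exists_prod_eq_of_involutive {α : Type*} [DecidableEq α] {e : α → α}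
    (he : Function.Involutive e) {F : α → ℂ} (hF : ∀ c, F (e c) = starRingEnd ℂ (F c))
    (hfix : ∀ c, e c = c → ∃ r : ℝ, r ≤ 0 ∧ F c = r) (S : Finset α) (hS : ∀ c ∈ S, e c ∈ S) :
    ∃ r : ℝ, 0 ≤ (-1) ^ S.card * r ∧ ∏ c ∈ S, F c = r := by
  induction S using Finset.strongInduction with
  | H S ih =>
    obtain rfl | ⟨c, hc⟩ := S.eq_empty_or_nonempty
    · exact ⟨1, by simp, by simp⟩
    by_cases hec : e c = c
    · obtain ⟨r, hr, hFr⟩ := hfix c hec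
      obtain ⟨t, ht, hFt⟩ := ih (S.erase c) (Finset.erase_ssubset hc) (by
        intro d hd
        rw [Finset.mem_erase] at hd ⊢
        refine ⟨fun h => hd.1 ?_, hS d hd.2⟩
        rw [← he d, h, hec])
      refine ⟨r * t, ?_, ?_⟩
      · rw [← Finset.card_erase_add_one hc, pow_succ]
        nlinarith
      · rw [← Finset.mul_prod_erase S F hc, hFr, hFt]
        push_cast
        rfl
    · have hc' : e c ∈ S.erase c := Finset.mem_erase.mpr ⟨hec, hS c hc⟩
      obtain ⟨t, ht, hFt⟩ := ih ((S.erase c).erase (e c))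
        ((Finset.erase_ssubset hc').trans (Finset.erase_ssubset hc)) (by
          intro d hd
          rw [Finset.mem_erase, Finset.mem_erase] at hd ⊢
          refine ⟨fun h => hd.2.1 (he.injective h), fun h => hd.1 ?_, hS d hd.2.2⟩
          rw [← h, he d])
      -- A swapped pair contributes `|F c|² ≥ 0` and leaves the parity of the cardinality unchanged.
      refine ⟨Complex.normSq (F c) * t, ?_, ?_⟩
      · rw [← Finset.card_erase_add_one hc, ← Finset.card_erase_add_one hc', add_assoc, pow_add]
        have := mul_nonneg (Complex.normSq_nonneg (F c)) ht
        norm_num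
        linarith
      · rw [← Finset.mul_prod_erase S F hc, ← Finset.mul_prod_erase _ F hc', hFt, hF,
          ← mul_assoc, Complex.mul_conj]
        push_cast
        rfl

/-! ### Uniqueness of the involution in a 2-subgroup -/

section UniqueInvolution

variable {G : Type*} [Group G] [Finite G]

/-- Two commuting involutions generate an elementary abelian 2-group; a maximal one containing it
has order 2, leaving room for only one involution. -/
theorem eq_of_commute_of_sq_eq_one
    (hG : ∀ E : Subgroup G, Maximal IsElementaryAbelianTwo E → Nat.card E = 2) {z t : G}
    (hzt : z * t = t * z) (hz : z ^ 2 = 1) (ht : t ^ 2 = 1) (hz1 : z ≠ 1) (ht1 : t ≠ 1) :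
    t = z := by
  have hE : IsElementaryAbelianTwo (Subgroup.closure {z, t}) := by
    have hcomm : ∀ x ∈ Subgroup.closure {z, t}, ∀ y ∈ Subgroup.closure {z, t}, x * y = y * x := by
      have hpair : ∀ x ∈ ({z, t} : Set G), ∀ y ∈ ({z, t} : Set G), x * y = y * x := by
        rintro x (rfl | rfl) y (rfl | rfl) <;> simp [hzt]
      intro x hx y hy
      have := Subgroup.isMulCommutative_closure hpair
      exact congrArg Subtype.val
        (mul_comm' (⟨x, hx⟩ : Subgroup.closure {z, t}) ⟨y, hy⟩)
    refine ⟨hcomm, fun x hx => ?_⟩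
    induction hx using Subgroup.closure_induction with
    | mem x hx => rcases hx with rfl | rfl <;> assumption
    | one => exact one_pow 2
    | mul x y hx hy hx' hy' => rw [Commute.mul_pow (hcomm x hx y hy), hx', hy', one_mul]
    | inv x _ hx' => rw [inv_pow, hx', inv_one]
  obtain ⟨M, hEM, hM⟩ := Finite.exists_le_maximal hE
  have hzM : z ∈ M := hEM (Subgroup.subset_closure (by simp))
  have htM : t ∈ M := hEM (Subgroup.subset_closure (by simp))
  obtain ⟨x, -, huniq⟩ := (Nat.card_eq_two_iff' (1 : M)).mp (hG M hM)
  have hz' := huniq ⟨z, hzM⟩ fun h => hz1 (congrArg Subtype.val h)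
  have ht' := huniq ⟨t, htM⟩ fun h => ht1 (congrArg Subtype.val h)
  exact congrArg Subtype.val (ht'.trans hz'.symm)

/-- The involution of a 2-subgroup `K` is unique and central in `K`. -/
theorem exists_unique_involution
    (hG : ∀ E : Subgroup G, Maximal IsElementaryAbelianTwo E → Nat.card E = 2)
    {H K : Subgroup G} (hHK : H ≤ K) (hH : Nat.card H = 2) (hK : IsPGroup 2 K) :
    ∃ ι ∈ H, ι ≠ 1 ∧ (∀ σ, σ ∈ H ↔ σ = 1 ∨ σ = ι) ∧ (∀ κ ∈ K, κ * ι = ι * κ) ∧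
      ∀ t ∈ K, t ^ 2 = 1 → t ≠ 1 → t = ι := by
  obtain ⟨x, hx, huniq⟩ := (Nat.card_eq_two_iff' (1 : H)).mp hH
  have hxsq : (x : G) ^ 2 = 1 := by
    have := pow_card_eq_one' (x := x)
    rw [hH] at this
    exact congrArg Subtype.val this
  have hx1 : (x : G) ≠ 1 := fun h => hx (Subtype.ext h)
  have : Fact (Nat.Prime 2) := ⟨Nat.prime_two⟩
  have hne : Nontrivial K := ⟨⟨⟨x, hHK x.2⟩, 1, fun h => hx1 (congrArg Subtype.val h)⟩⟩
  -- A nontrivial 2-group has a central involution `z`. Every involution of `K` commutes with it,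
  -- hence equals it.
  have := hK.center_nontrivial
  obtain ⟨k, hk0, hk⟩ := (hK.to_subgroup (Subgroup.center K)).nontrivial_iff_card.mp this
  obtain ⟨z, hz⟩ := exists_prime_orderOf_dvd_card' (G := Subgroup.center K) 2
    (hk ▸ dvd_pow_self 2 hk0.ne')
  have hzcomm : ∀ κ ∈ K, κ * (z : K) = (z : K) * κ := fun κ hκ =>
    congrArg Subtype.val (Subgroup.mem_center_iff.mp z.2 ⟨κ, hκ⟩)
  have hzsq : ((z : K) : G) ^ 2 = 1 := by
    have := pow_orderOf_eq_one z
    rw [hz] at this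
    exact congrArg (fun u : Subgroup.center K => ((u : K) : G)) this
  have hz1 : ((z : K) : G) ≠ 1 := by
    intro h
    have : z = 1 := Subtype.ext (Subtype.ext h)
    simp [this] at hz
  have huz : ∀ t ∈ K, t ^ 2 = 1 → t ≠ 1 → t = (z : K) := fun t ht ht2 ht1 =>
    eq_of_commute_of_sq_eq_one hG (hzcomm t ht).symm hzsq ht2 hz1 ht1
  have hxz := huz x (hHK x.2) hxsq hx1
  refine ⟨x, x.2, hx1, fun σ => ⟨fun hσ => ?_, ?_⟩, ?_, ?_⟩
  · by_cases h : σ = 1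
    · exact Or.inl h
    · exact Or.inr (congrArg Subtype.val
        (huniq ⟨σ, hσ⟩ fun h' => h (congrArg Subtype.val h')))
  · rintro (rfl | rfl)
    exacts [H.one_mem, x.2]
  · rwa [hxz]
  · rwa [hxz]

end UniqueInvolution
-- Invariance, nonnegativity and nonvanishing of the coset product
section CosetProduct

variable {G : Type*} [Group G] [Fintype G] {n : ℕ} (ρ : G →* GL (Fin n) ℝ)

theorem cosetFactor_mk (K : Subgroup G) (h : MvPolynomial (Fin n) ℝ) (σ : G) :
    cosetFactor ρ K h (σ : G ⧸ K) = act ρ σ (reynolds ρ K h) := rfl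

theorem cosetFactor_smul (K : Subgroup G) (h : MvPolynomial (Fin n) ℝ) (σ : G) (c : G ⧸ K) :
    cosetFactor ρ K h (σ • c) = act ρ σ (cosetFactor ρ K h c) := by
  induction c using QuotientGroup.induction_on with
  | H τ => rw [MulAction.Quotient.smul_coe, smul_eq_mul, cosetFactor_mk, cosetFactor_mk, act_mul]

theorem cosetProduct_mem_invariants (H K : Subgroup G) : cosetProduct ρ H K ∈ invariants ρ := by
  intro σ
  classical
  unfold cosetProduct
  rw [map_prod]
  refine Fintype.prod_equiv (MulAction.toPerm σ) _ _ fun c => ?_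
  rw [MulAction.toPerm_apply, cosetFactor_smul]

theorem reynolds_of_mem_iff {H : Subgroup G} {ι : G} (hH : ∀ σ, σ ∈ H ↔ σ = 1 ∨ σ = ι)
    (hι : ι ≠ 1) (h : MvPolynomial (Fin n) ℝ) :
    reynolds ρ H h = (2 : ℝ)⁻¹ • (h + act ρ ι h) := by
  classical
  have hf : (Finset.univ.filter (fun σ : G => σ ∈ H)) = {1, ι} := by
    ext σ
    simp [hH]
  have hcard : Nat.card H = 2 := by
    rw [Nat.card_eq_fintype_card, Fintype.card_subtype, hf, Finset.card_pair hι.symm]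
  unfold reynolds
  rw [hcard]
  have : ∑ σ ∈ Finset.univ.filter (fun σ : G => σ ∈ H), act ρ σ h = h + act ρ ι h := by
    rw [hf, Finset.sum_pair hι.symm, act_one]
  congr 1

theorem eval_reynolds_nonneg (K : Subgroup G) {h : MvPolynomial (Fin n) ℝ}
    (hh : ∀ x, 0 ≤ eval x h) (x : Fin n → ℝ) : 0 ≤ eval x (reynolds ρ K h) := by
  unfold reynolds
  rw [smul_eval, map_sum]
  refine mul_nonneg (by positivity) (Finset.sum_nonneg fun σ _ => ?_)
  rw [eval_act]
  exact hh _

/-- Nonnegative summands cannot cancel, and the summand for `σ = 1` is `h` itself. -/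
theorem reynolds_ne_zero (K : Subgroup G) {h : MvPolynomial (Fin n) ℝ}
    (hh : ∀ x, 0 ≤ eval x h) (h0 : h ≠ 0) : reynolds ρ K h ≠ 0 := by
  intro hR
  refine h0 (MvPolynomial.funext fun x => ?_)
  have hx := congrArg (eval x) hR
  unfold reynolds at hx
  rw [smul_eval, map_sum, map_zero, mul_eq_zero, inv_eq_zero, Nat.cast_eq_zero] at hx
  have hx := hx.resolve_left Nat.card_pos.ne'
  rw [Finset.sum_eq_zero_iff_of_nonneg fun σ _ => by rw [eval_act]; exact hh _] at hx
  have := hx 1 (by simp [K.one_mem])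
  rwa [act_one] at this

theorem eval_cosetProduct_nonneg (H K : Subgroup G) (x : Fin n → ℝ) :
    0 ≤ eval x (cosetProduct ρ H K) := by
  unfold cosetProduct
  rw [map_prod]
  refine Finset.prod_nonneg fun c _ => ?_
  induction c using QuotientGroup.induction_on with
  | H τ =>
    rw [cosetFactor_mk, eval_act]
    refine eval_reynolds_nonneg ρ K (fun y => ?_) _
    rw [map_sum]
    exact Finset.sum_nonneg fun i _ => by rw [map_pow]; positivity

variable {ρ} in
-- If a factor were zero, every square in the sum would vanish, so `ι` would fix all coordinates,
-- contradicting faithfulness.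
theorem cosetProduct_ne_zero (hρ : Function.Injective ρ) {H : Subgroup G} (K : Subgroup G) {ι : G}
    (hH : ∀ σ, σ ∈ H ↔ σ = 1 ∨ σ = ι) (hι : ι ≠ 1) : cosetProduct ρ H K ≠ 0 := by
  have hf (x : Fin n → ℝ) (i : Fin n) : 0 ≤ eval x ((X i - reynolds ρ H (X i)) ^ 2) := by
    rw [map_pow]
    positivity
  unfold cosetProduct
  refine Finset.prod_ne_zero_iff.mpr fun c _ => ?_
  induction c using QuotientGroup.induction_on with
  | H τ =>
    rw [cosetFactor_mk]
    refine (map_ne_zero_iff _ (act_injective ρ τ)).mpr (reynolds_ne_zero ρ K (fun x => ?_) ?_)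
    · rw [map_sum]
      exact Finset.sum_nonneg fun i _ => hf x i
    intro h0
    have hX (i : Fin n) : act ρ ι (X i) = X i := by
      apply MvPolynomial.funext
      intro x
      have hx := congrArg (eval x) h0
      rw [map_sum, map_zero, Finset.sum_eq_zero_iff_of_nonneg fun i _ => hf x i] at hx
      have := hx i (Finset.mem_univ i)
      rw [map_pow, sq_eq_zero_iff, reynolds_of_mem_iff ρ hH hι, map_sub, smul_eval, map_add] at this
      linarith
    refine hι (inv_eq_one.mp (hρ ?_))
    rw [map_one]
    ext i j
    have := congrArg (eval (Pi.single j (1 : ℝ))) (hX i)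
    rw [eval_act, eval_X, eval_X, Matrix.mulVec_single_one] at this
    rw [Matrix.GeneralLinearGroup.coe_one, Matrix.one_eq_pi_single, Pi.single_comm]
    simpa [Matrix.col, Pi.single_comm] using this

end CosetProduct

/-! ### Sign of the coset product at nonreal points -/

section ComplexPoints

variable {G : Type*} [Group G] {n : ℕ} {ρ : G →* GL (Fin n) ℝ}
  {ψ : MvPolynomial (Fin n) ℝ →ₐ[ℝ] ℂ}

theorem exists_eq_eval_of_conj_eq (hψ : ∀ h, starRingEnd ℂ (ψ h) = ψ h) :
    ∃ x : Fin n → ℝ, ∀ h, ψ h = (eval x h : ℝ) := by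
  refine ⟨fun i => (ψ (X i)).re, fun h => ?_⟩
  have : ψ = Complex.ofRealAm.comp (aeval fun i => (ψ (X i)).re) := by
    apply MvPolynomial.algHom_ext
    intro i
    rw [AlgHom.comp_apply, aeval_X]
    exact (Complex.conj_eq_iff_re.mp (hψ (X i))).symm
  conv_lhs => rw [this]
  rfl

/-- Conjugating twice is the identity, so even powers of `s` are invisible at `ψ`. -/
theorem apply_act_pow_two_mul {s : G} (hs : ∀ h, starRingEnd ℂ (ψ h) = ψ (act ρ s h)) (k : ℕ)
    (h : MvPolynomial (Fin n) ℝ) : ψ (act ρ (s ^ (2 * k)) h) = ψ h := by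
  induction k with
  | zero => rw [mul_zero, pow_zero, act_one]
  | succ k ih =>
    rw [mul_add, mul_one, add_comm, pow_add, pow_two, act_mul, act_mul, ← hs, ← hs,
      Complex.conj_conj, ih]

/-- If complex conjugation acts on a complex point like an element of `G`, then it acts like an
element whose order is a power of 2. -/
theorem exists_conj_eq_act_of_order_two_pow [Finite G] {s : G}
    (hs : ∀ h, starRingEnd ℂ (ψ h) = ψ (act ρ s h)) :
    ∃ s' : G, (∃ a, s' ^ 2 ^ a = 1) ∧ ∀ h, starRingEnd ℂ (ψ h) = ψ (act ρ s' h) := by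
  -- With `k` the odd part of the order, `s ^ k` has 2-power order and differs from `s` by an even
  -- power of `s`.
  obtain ⟨a, k, hk, hak⟩ := Nat.exists_eq_two_pow_mul_odd (orderOf_pos s).ne'
  refine ⟨s ^ k, ⟨a, ?_⟩, fun h => ?_⟩
  · rw [← pow_mul, mul_comm, ← hak, pow_orderOf_eq_one]
  · obtain ⟨j, rfl⟩ := hk
    rw [add_comm, pow_add, pow_one, act_mul, ← hs, apply_act_pow_two_mul hs]

variable [Fintype G]

/-- At a nonreal complex point that is conjugated by an element of `K`, the averaged sum of squares
is nonpositive, and it vanishes unless this element is an involution. -/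
theorem exists_apply_reynolds_eq {H K : Subgroup G} {ι : G}
    (hH : ∀ σ, σ ∈ H ↔ σ = 1 ∨ σ = ι) (hι : ι ≠ 1) (hcomm : ∀ κ ∈ K, κ * ι = ι * κ)
    (huniq : ∀ t ∈ K, t ^ 2 = 1 → t ≠ 1 → t = ι) {s : G} (hsK : s ∈ K) (hs1 : s ≠ 1)
    (hs2 : ∃ a, s ^ 2 ^ a = 1) (hs : ∀ h, starRingEnd ℂ (ψ h) = ψ (act ρ s h)) :
    ∃ r : ℝ, r ≤ 0 ∧ ψ (reynolds ρ K (∑ i, (X i - reynolds ρ H (X i)) ^ 2)) = r ∧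
      (s ^ 2 ≠ 1 → r = 0) := by
  have key : ∀ h, ∃ r : ℝ, r ≤ 0 ∧ ((2 : ℂ)⁻¹ * (ψ h - ψ (act ρ ι h))) ^ 2 = r ∧
      (s ^ 2 ≠ 1 → r = 0) := by
    intro h
    by_cases hsq : s ^ 2 = 1
    -- Here `s = ι`, so half the difference is `i` times the imaginary part of `ψ h`.
    · refine ⟨-(ψ h).im ^ 2, by nlinarith [sq_nonneg (ψ h).im], ?_, fun h => absurd hsq h⟩
      rw [← huniq s hsK hsq hs1, ← hs, Complex.sub_conj]
      push_cast
      ring_nf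
      rw [Complex.I_sq]
      ring
    · refine ⟨0, le_rfl, ?_, fun _ => rfl⟩
      have hex := hs2
      obtain ⟨a, ha, hmin⟩ : ∃ a, s ^ 2 ^ a = 1 ∧ ∀ b < a, s ^ 2 ^ b ≠ 1 := by
        classical
        exact ⟨Nat.find hex, Nat.find_spec hex, fun b hb => Nat.find_min hex hb⟩
      obtain _ | _ | a := a
      · exact absurd (by simpa using ha) hs1
      · exact absurd (by simpa using ha) hsq
      -- The order of `s` is now `2 ^ (a + 2)`, so `ι` is an even power of `s` and acts trivially at
      -- `ψ`.
      have hpow : s ^ 2 ^ (a + 1) = ι :=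
        huniq _ (K.pow_mem hsK _) (by rw [← pow_mul, ← pow_succ, ha]) (hmin (a + 1) (by omega))
      rw [← hpow, pow_succ' 2 a, apply_act_pow_two_mul hs]
      simp
  have hsum : ∀ κ ∈ K, ∃ r : ℝ, r ≤ 0 ∧
      ψ (act ρ κ (∑ i, (X i - reynolds ρ H (X i)) ^ 2)) = r ∧ (s ^ 2 ≠ 1 → r = 0) := by
    intro κ hκ
    choose r hr0 hr hrz using fun i : Fin n => key (act ρ κ (X i))
    refine ⟨∑ i, r i, Finset.sum_nonpos fun i _ => hr0 i, ?_, fun h =>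
      Finset.sum_eq_zero fun i _ => hrz i h⟩
    rw [map_sum, map_sum, Complex.ofReal_sum]
    refine Finset.sum_congr rfl fun i _ => ?_
    -- Since `ι` is central in `K`, applying `κ` to `X i - R_H (X i)` gives half the difference of
    -- `κ (X i)` and `ι (κ (X i))`.
    rw [← hr, reynolds_of_mem_iff ρ hH hι, ← act_mul, ← hcomm κ hκ, act_mul, map_pow, map_pow,
      map_sub, map_sub, map_smul, map_smul, map_add, map_add, Complex.real_smul]
    push_cast
    ring
  choose r hr0 hr hrz using hsum
  classical
  refine ⟨(Nat.card K : ℝ)⁻¹ * ∑ κ : G, if hκ : κ ∈ K then r κ hκ else 0,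
    mul_nonpos_of_nonneg_of_nonpos (by positivity) (Finset.sum_nonpos fun κ _ => ?_), ?_, ?_⟩
  · split_ifs with hκ
    exacts [hr0 κ hκ, le_rfl]
  · unfold reynolds
    rw [map_smul, Complex.real_smul, map_sum, Finset.sum_filter, Complex.ofReal_mul,
      Complex.ofReal_sum]
    congr 1
    refine Finset.sum_congr rfl fun κ _ => ?_
    split_ifs with hκ
    exacts [hr κ hκ, Complex.ofReal_zero.symm]
  · intro h
    rw [Finset.sum_eq_zero, mul_zero]
    intro κ _
    split_ifs with hκ
    exacts [hrz κ hκ h, rfl]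

/-- At a nonreal complex point over a real point of the orbit space variety, the coset product is
nonpositive. -/
theorem re_apply_cosetProduct_nonpos {H K : Subgroup G} {ι : G}
    (hH : ∀ σ, σ ∈ H ↔ σ = 1 ∨ σ = ι) (hι : ι ≠ 1) (hcomm : ∀ κ ∈ K, κ * ι = ι * κ)
    (huniq : ∀ t ∈ K, t ^ 2 = 1 → t ≠ 1 → t = ι) (hK : Odd (Nat.card (G ⧸ K))) {s : G}
    (hs1 : s ≠ 1) (hs2 : ∃ a, s ^ 2 ^ a = 1)
    (hs : ∀ h, starRingEnd ℂ (ψ h) = ψ (act ρ s h)) :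
    (ψ (cosetProduct ρ H K)).re ≤ 0 := by
  classical
  set f : MvPolynomial (Fin n) ℝ := ∑ i, (X i - reynolds ρ H (X i)) ^ 2 with hf
  have hfix : ∀ c : G ⧸ K, s • c = c →
      ∃ r : ℝ, r ≤ 0 ∧ ψ (cosetFactor ρ K f c) = r ∧ (s ^ 2 ≠ 1 → r = 0) := by
    intro c
    induction c using QuotientGroup.induction_on with
    | H τ =>
      intro hc
      have hmem : τ⁻¹ * s * τ ∈ K := by
        rw [MulAction.Quotient.smul_coe, smul_eq_mul] at hc
        rw [mul_assoc]
        exact QuotientGroup.eq.mp hc.symm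
      have hconj : τ⁻¹ * s * τ = τ⁻¹ * s * (τ⁻¹)⁻¹ := by rw [inv_inv]
      -- The translated point `ψ ∘ τ` is conjugated by `τ⁻¹ s τ`, which lies in `K` because `s`
      -- fixes the coset of `τ`.
      obtain ⟨r, hr0, hr, hrz⟩ := exists_apply_reynolds_eq (ψ := ψ.comp (act ρ τ)) (ρ := ρ)
        hH hι hcomm huniq hmem (by rwa [hconj, ne_eq, conj_eq_one_iff])
        (hs2.imp fun a ha => by rw [hconj, conj_pow, ha, mul_one, mul_inv_cancel])
        (fun h => by
          rw [AlgHom.comp_apply, AlgHom.comp_apply, hs, ← act_mul, ← act_mul, mul_assoc,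
            mul_inv_cancel_left])
      refine ⟨r, hr0, hr, fun h => hrz ?_⟩
      rwa [hconj, conj_pow, ne_eq, conj_eq_one_iff]
  have hprod : ψ (cosetProduct ρ H K) = ∏ c : G ⧸ K, ψ (cosetFactor ρ K f c) := by
    unfold cosetProduct
    rw [map_prod]
  by_cases hsq : s ^ 2 = 1
  · obtain ⟨r, hr0, hr⟩ := exists_prod_eq_of_involutive (e := fun c : G ⧸ K => s • c)
      (fun c => by simp only [smul_smul, ← pow_two, hsq, one_smul])
      (F := fun c => ψ (cosetFactor ρ K f c)) (fun c => by rw [cosetFactor_smul, hs])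
      (fun c hc => (hfix c hc).imp fun r hr => ⟨hr.1, hr.2.1⟩) Finset.univ
      (fun c _ => Finset.mem_univ _)
    rw [Finset.card_univ, ← Nat.card_eq_fintype_card, hK.neg_one_pow] at hr0
    rw [hprod, hr, Complex.ofReal_re]
    linarith
  · have : Fact (Nat.Prime 2) := ⟨Nat.prime_two⟩
    have hP : IsPGroup 2 (Subgroup.zpowers s) := by
      obtain ⟨a, ha⟩ := hs2
      rintro ⟨_, k, rfl⟩
      refine ⟨a, Subtype.ext ?_⟩
      change (s ^ k) ^ 2 ^ a = 1
      rw [← zpow_natCast, ← zpow_mul, mul_comm, zpow_mul, zpow_natCast, ha, one_zpow]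
    -- A 2-group acting on a set of odd size has a fixed point; the factor at this coset is zero.
    obtain ⟨c, hc⟩ := hP.nonempty_fixed_point_of_prime_not_dvd_card (G ⧸ K) hK.not_two_dvd_nat
    have hsc : s • c = c := hc ⟨s, Subgroup.mem_zpowers s⟩
    obtain ⟨r, -, hr, hr0⟩ := hfix c hsc
    rw [hprod, Finset.prod_eq_zero (Finset.mem_univ c) (by rw [hr, hr0 hsq, Complex.ofReal_zero])]
    rfl

end ComplexPoints

/-! ### Dimension drop and the generic description -/

section GenericDescription

variable {G : Type*} [Group G] {n m : ℕ} {ρ : G →* GL (Fin n) ℝ}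
  {p : Fin m → MvPolynomial (Fin n) ℝ}

theorem eval_hilbertMap (q : MvPolynomial (Fin m) ℝ) (x : Fin n → ℝ) :
    eval (hilbertMap p x) q = eval x (aeval p q) := by
  induction q using MvPolynomial.induction_on with
  | C a => simp
  | add p q hp hq => simp [hp, hq]
  | mul_X q i hq => simp [hq, hilbertMap]

theorem hilbertMap_mem_relationVariety (x : Fin n → ℝ) :
    hilbertMap p x ∈ relationVariety p := by
  intro q hq
  have hq : aeval p q = 0 := hq
  change eval (hilbertMap p x) q = 0
  rw [eval_hilbertMap, hq, map_zero]

theorem phi_hilbertMap (hp : Algebra.adjoin ℝ (Set.range p) = invariants ρ) (x : Fin n → ℝ)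
    (hz : hilbertMap p x ∈ relationVariety p) (g : invariants ρ) :
    phi hp (hilbertMap p x) hz g = eval x (g : MvPolynomial (Fin n) ℝ) := by
  obtain ⟨q, rfl⟩ := toInvariants_surjective hp g
  rw [phi_toInvariants, eval_hilbertMap]
  rfl

/-- A real polynomial vanishing on all of `ℝⁿ` is zero. This makes the vanishing ideal prime, which
the dimension drop needs. -/
theorem vanishingIdeal_range_hilbertMap :
    vanishingIdeal ℝ (Set.range (hilbertMap p)) = relationIdeal p := by
  ext q
  rw [mem_vanishingIdeal_iff]
  constructor
  · intro h
    refine MvPolynomial.funext fun x => ?_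
    have : eval (hilbertMap p x) q = 0 := h _ ⟨x, rfl⟩
    rwa [eval_hilbertMap] at this
  · rintro hq _ ⟨x, rfl⟩
    exact hilbertMap_mem_relationVariety x q hq

/-- A subset of the orbit space on which a nonzero polynomial function of the orbit space vanishes
has smaller dimension. -/
theorem dim_lt_of_eval_eq_zero {T : Set (Fin m → ℝ)} (hT : T ⊆ Set.range (hilbertMap p))
    {q : MvPolynomial (Fin m) ℝ} (hq : aeval p q ≠ 0) (hqT : ∀ z ∈ T, eval z q = 0) :
    dim T < dim (Set.range (hilbertMap p)) := by
  have hle : vanishingIdeal ℝ (Set.range (hilbertMap p)) ≤ vanishingIdeal ℝ T :=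
    vanishingIdeal_anti_mono hT
  have hprime : (vanishingIdeal ℝ (Set.range (hilbertMap p))).IsPrime := by
    rw [vanishingIdeal_range_hilbertMap]
    exact RingHom.ker_isPrime _
  have hmem : Ideal.Quotient.mk (vanishingIdeal ℝ (Set.range (hilbertMap p))) q ≠ 0 := by
    rw [ne_eq, Ideal.Quotient.eq_zero_iff_mem, vanishingIdeal_range_hilbertMap]
    exact hq
  -- In the coordinate domain of the orbit space the class of `q` is a nonzerodivisor, and it dies
  -- in the coordinate ring of `T`.
  have hsucc : dim T + 1 ≤ dim (Set.range (hilbertMap p)) :=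
    ringKrullDim_succ_le_of_surjective (Ideal.Quotient.factor hle)
      (Ideal.Quotient.factor_surjective hle) (mem_nonZeroDivisors_of_ne_zero hmem) (by
        rw [Ideal.Quotient.factor_mk, Ideal.Quotient.eq_zero_iff_mem, mem_vanishingIdeal_iff]
        exact hqT)
  -- The inequality becomes strict only because the larger dimension is neither `⊤` nor `⊥`.
  have hfin : dim (Set.range (hilbertMap p)) ≤ (m : ℕ) := by
    refine (ringKrullDim_quotient_le _).trans ?_
    rw [MvPolynomial.ringKrullDim_of_isNoetherianRing, ringKrullDim_eq_zero_of_field]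
    simp
  have hbot : dim (Set.range (hilbertMap p)) ≠ ⊥ := by
    refine ne_bot_of_le_ne_bot WithBot.coe_ne_bot
      (ringKrullDim_nonneg_of_nontrivial (R := MvPolynomial (Fin m) ℝ ⧸ _))
  obtain ⟨d, hd⟩ := WithBot.ne_bot_iff_exists.mp hbot
  rw [← hd] at hsucc hfin ⊢
  have hdm : d ≤ (m : ℕ∞) := WithBot.coe_le_coe.mp hfin
  lift d to ℕ using ne_top_of_le_ne_top (ENat.natCast_ne_top m) hdm
  by_contra hlt
  have h1 : ((d + 1 : ℕ) : WithBot ℕ∞) ≤ (d : ℕ) := by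
    push_cast
    exact (add_le_add_left (not_lt.mp hlt) 1).trans hsucc
  have := Nat.cast_le.mp h1
  omega

theorem genericallyDescribedBy_cosetProduct [Fintype G] (hρ : Function.Injective ρ)
    (hp : Algebra.adjoin ℝ (Set.range p) = invariants ρ)
    (hG : ∀ E : Subgroup G, Maximal IsElementaryAbelianTwo E → Nat.card E = 2)
    {H K : Subgroup G} (hHK : H ≤ K) (hH : Nat.card H = 2) (hK : IsPGroup 2 K)
    (hodd : Odd (Nat.card (G ⧸ K))) :
    GenericallyDescribedBy hp ![⟨cosetProduct ρ H K, cosetProduct_mem_invariants ρ H K⟩] := by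
  obtain ⟨ι, -, hι, hHι, hcomm, huniq⟩ := exists_unique_involution hG hHK hH hK
  set g : invariants ρ := ⟨cosetProduct ρ H K, cosetProduct_mem_invariants ρ H K⟩ with hg
  obtain ⟨q, hq⟩ := toInvariants_surjective hp g
  have hqg : aeval p q = cosetProduct ρ H K := congrArg Subtype.val hq
  refine ⟨{z ∈ Set.range (hilbertMap p) | eval z q = 0},
    dim_lt_of_eval_eq_zero (fun z hz => hz.1) (q := q)
      (hqg ▸ cosetProduct_ne_zero hρ K hHι hι) (fun z hz => hz.2), ?_⟩
  apply Set.Subset.antisymm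
  · rintro _ ⟨x, rfl⟩
    have hev : eval (hilbertMap p x) q = eval x (cosetProduct ρ H K) := by
      rw [eval_hilbertMap, hqg]
    obtain h | h := (eval_cosetProduct_nonneg ρ H K x).lt_or_eq
    · refine Or.inl ⟨hilbertMap_mem_relationVariety x, fun i => ?_⟩
      rw [Matrix.cons_val_fin_one, phi_hilbertMap]
      exact h
    · exact Or.inr ⟨⟨x, rfl⟩, hev.trans h.symm⟩
  · rintro z (⟨hz, hpos⟩ | hz)
    · have hpos : 0 < phi hp z hz g := hpos 0
      have := isIntegral_invariants ρ
      obtain ⟨ψ, hψ⟩ := exists_algHom_complex_extending (invariants ρ) (phi hp z hz)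
      have hreal : ∀ h, starRingEnd ℂ (ψ h) = ψ h := by
        obtain ⟨s, hs⟩ := exists_eq_comp_act (ρ := ρ) (ψ := ψ)
          (ψ' := Complex.conjAe.toAlgHom.comp ψ) (fun h hh => by
            change ψ h = starRingEnd ℂ (ψ h)
            rw [hψ ⟨h, hh⟩, Complex.conj_ofReal])
        obtain ⟨s', hs2, hs'⟩ := exists_conj_eq_act_of_order_two_pow (ρ := ρ) (ψ := ψ)
          (s := s) (fun h => DFunLike.congr_fun hs h)
        by_cases h1 : s' = 1
        · intro h
          rw [hs', h1, act_one]
        · have hneg := re_apply_cosetProduct_nonpos hHι hι hcomm huniq hodd h1 hs2 hs'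
          rw [hψ g, Complex.ofReal_re] at hneg
          exact absurd hpos hneg.not_gt
      obtain ⟨x, hx⟩ := exists_eq_eval_of_conj_eq hreal
      refine ⟨x, funext fun j => ?_⟩
      have hj := hψ (toInvariants hp (X j))
      rw [phi_toInvariants, hx, Complex.ofReal_inj, eval_X] at hj
      rw [← hj]
      change eval x (p j) = eval x (aeval p (X j))
      rw [aeval_X]
    · exact hz.1

end GenericDescription

/-- The trivial subgroup lies in some maximal elementary abelian one. This gives `l ≥ 1`, so that `H
1` is part of the chain. -/
theorem even_card_of_maximal_elementaryAbelianTwo {G : Type*} [Group G] [Finite G]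
    (hG : ∀ E : Subgroup G, Maximal IsElementaryAbelianTwo E → Nat.card E = 2) :
    2 ∣ Nat.card G := by
  have h1 : IsElementaryAbelianTwo (⊥ : Subgroup G) := by
    constructor <;> simp [Subgroup.mem_bot]
  obtain ⟨M, -, hM⟩ := Finite.exists_le_maximal h1
  exact hG M hM ▸ M.card_subgroup_dvd_card

end OrbitSpace
end

theorem mainTheorem3 {G : Type*} [Group G] [Fintype G] {n m : ℕ}
    (ρ : G →* GL (Fin n) ℝ) (hρ : Function.Injective ρ)
    (p : Fin m → MvPolynomial (Fin n) ℝ)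
    (hp : Algebra.adjoin ℝ (Set.range p) = OrbitSpace.invariants ρ)
    (hG : ∀ E : Subgroup G, Maximal OrbitSpace.IsElementaryAbelianTwo E → Nat.card E = 2) :
    (∃ g : OrbitSpace.invariants ρ, OrbitSpace.GenericallyDescribedBy hp ![g]) ∧
    ∀ (q l : ℕ) (H : ℕ → Subgroup G), Odd q → Nat.card G = q * 2 ^ l →
      (∀ i, 1 ≤ i → i ≤ l → Nat.card (H i) = 2 ^ i) →
      (∀ i, 1 ≤ i → i < l → H i ≤ H (i + 1)) →
      ∃ hg : OrbitSpace.cosetProduct ρ (H 1) (H l) ∈ OrbitSpace.invariants ρ,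
        OrbitSpace.GenericallyDescribedBy hp ![⟨OrbitSpace.cosetProduct ρ (H 1) (H l), hg⟩] := by
  have h2 := OrbitSpace.even_card_of_maximal_elementaryAbelianTwo hG
  have : Fact (Nat.Prime 2) := ⟨Nat.prime_two⟩
  have hmain : ∀ (q l : ℕ) (H K : Subgroup G), Odd q → Nat.card G = q * 2 ^ l →
      Nat.card H = 2 → Nat.card K = 2 ^ l → H ≤ K →
      OrbitSpace.GenericallyDescribedBy hp
        ![⟨OrbitSpace.cosetProduct ρ H K, OrbitSpace.cosetProduct_mem_invariants ρ H K⟩] := by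
    intro q l H K hq hcard hH hK hHK
    refine OrbitSpace.genericallyDescribedBy_cosetProduct hρ hp hG hHK hH (IsPGroup.of_card hK) ?_
    have hquot := K.card_eq_card_quotient_mul_card_subgroup
    rw [hcard, hK] at hquot
    rwa [← Nat.eq_of_mul_eq_mul_right (by positivity) hquot]
  have hl : ∀ q l : ℕ, Odd q → Nat.card G = q * 2 ^ l → 1 ≤ l := by
    intro q l hq hcard
    rw [Nat.one_le_iff_ne_zero]
    rintro rfl
    rw [hcard, pow_zero, mul_one] at h2
    exact hq.not_two_dvd_nat h2
  constructor
  · obtain ⟨l, q, hq, hcard⟩ := Nat.exists_eq_two_pow_mul_odd (n := Nat.card G) Nat.card_pos.ne'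
    rw [mul_comm] at hcard
    obtain ⟨H, hH⟩ := Sylow.exists_subgroup_card_pow_prime (G := G) 2 (n := 1) (by simpa using h2)
    obtain ⟨K, hK, hHK⟩ := Sylow.exists_subgroup_card_pow_prime_le 2 (m := l)
      (hcard ▸ Dvd.intro_left q rfl) H hH (hl q l hq hcard)
    exact ⟨_, hmain q l H K hq hcard (by simpa using hH) hK hHK⟩
  · intro q l H hq hcard hH hmono
    have hle : ∀ i, 1 ≤ i → i ≤ l → H 1 ≤ H i := by
      intro i hi
      induction i, hi using Nat.le_induction with
      | base => exact fun _ => le_rfl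
      | succ i hi ih => exact fun h => (ih (by omega)).trans (hmono i hi (by omega))
    have hl1 := hl q l hq hcard
    exact ⟨_, hmain q l (H 1) (H l) hq hcard (by simpa using hH 1 le_rfl hl1)
      (hH l hl1 le_rfl) (hle l hl1 le_rfl)⟩
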